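/- Let $N\ge 1$. A cube is a (non-degenerate) cube in $\mathbb R^N$ with edges parallel to the coordinate axes; $|Q|$ is its Lebesgue measure and $f_Q=\frac{1}{|Q|}\int_Q f$. For locally integrable $f$ let $$f^{\#}(x)=\sup_{Q\ni x}\frac{1}{|Q|}\int_Q|f-f_Q|\in[0,\infty],\qquad x\in\mathbb R^N,$$ the supremum being over all cubes containing $x$, and let $$f^{\#*}(t)=\inf\{s\ge 0: |\{x\in\mathbb R^N: f^{\#}(x)>s\}|\le t\},\qquad t>0,$$ be the non-increasing rearrangement of $f^{\#}$. There exists a constant $C_N>0$, depending only on $N$, with the following property. Let $p\in[1,\infty)$ and let $\{\rho_\varepsilon\}_{\varepsilon>0}$ be a family of non-negative functions on $(0,\infty)$, vanishing outside $(0,1)$, with $\int_0^\infty\rho_\varepsilon(t)\,dt=1$ for every $\varepsilon>0$. Define $$\eta_{\varepsilon,p}(t)=\int_{t^{1/p}}^1\frac{\rho_\varepsilon(u)}{u^p}\,du,\qquad t\in(0,1).$$ Then $$\bigg(\frac{1}{|Q|}\int_Q|f-f_Q|^p\bigg)^{1/p}\le C_N\,p\,\bigg(\frac1{|Q|}\int_0^{|Q|}f^{\#*}(t)^p\,\eta_{\varepsilon,p}\Big(\frac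 t{|Q|}\Big)\,dt\bigg)^{1/p}$$ for every (real- or complex-valued) $f\in L^p(\mathbb R^N)$, every $\varepsilon>0$ and every cube $Q$, where the right-hand side may be $+\infty$. -/

import Mathlib

open MeasureTheory

noncomputable section

/-- The closed cube in `ℝ^N` with edges parallel to the coordinate axes, lower corner `a` and
edge length `ℓ` (used only for `0 < ℓ`). -/
def cube {N : ℕ} (a : Fin N → ℝ) (ℓ : ℝ) : Set (Fin N → ℝ) :=
  Set.Icc a (fun i => a i + ℓ)

/-- The mean value `f_Q = ⨍_Q f` over the set `Q`. -/
def meanOn {N : ℕ} {𝕜 : Type*} [RCLike 𝕜] (f : (Fin N → ℝ) → 𝕜) (Q : Set (Fin N → ℝ)) : 𝕜 :=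
  ⨍ y, f y ∂(volume.restrict Q)

/-- The Fefferman-Stein maximal function `f^#(x) = sup_{Q ∋ x} ⨍_Q |f - f_Q|`, with values in
`[0, ∞]`; the supremum is over all cubes `Q` that contain `x`. -/
def sharpMaximal {N : ℕ} {𝕜 : Type*} [RCLike 𝕜] (f : (Fin N → ℝ) → 𝕜) (x : Fin N → ℝ) :
    ENNReal :=
  ⨆ (a : Fin N → ℝ) (ℓ : ℝ) (_ : 0 < ℓ) (_ : x ∈ cube a ℓ),
    ⨍⁻ y, ‖f y - meanOn f (cube a ℓ)‖ₑ ∂(volume.restrict (cube a ℓ))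

/-- The non-increasing rearrangement `g^*(t) = inf {s ≥ 0 : |{g > s}| ≤ t}` of a nonnegative
(extended-valued) function `g` on `ℝ^N`. The value `s = ∞` is admissible, so that the infimum is
`∞` when no finite `s` is. -/
def rearrangement {N : ℕ} (g : (Fin N → ℝ) → ENNReal) (t : ℝ) : ENNReal :=
  sInf {s : ENNReal | volume {x | s < g x} ≤ ENNReal.ofReal t}

/-- The weight `η_p(t) = ∫_{t^{1/p}}^1 ρ(u) / u^p du` attached to a nonnegative function `ρ`. -/
def etaWeight (ρ : ℝ → ℝ) (p t : ℝ) : ENNReal :=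
  ∫⁻ u in Set.Ioo (t ^ (1 / p)) 1, ENNReal.ofReal (ρ u / u ^ p)

end

/-!
The weight only increases the right-hand side. By Tonelli, the weighted integral of
`A = (f^{#*}) ^ p` is an average, against the probability density `ρ_ε`, of the means of `A` over
intervals `(0, u ^ p |Q|)` with `u < 1`; since `A` is non-increasing, each of these is at least the
mean over `(0, |Q|)` (`lintegral_le_lintegral_mul_etaWeight`). Also
`∫_Q (f^#) ^ p ≤ ∫_0^{|Q|} (f^{#*}) ^ p` (`setLIntegral_rpow_le_lintegral_rearrangement`). What is
left is the local Fefferman-Stein inequality `setLIntegral_sub_mean_le_sharpMaximal`, with a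
constant linear in `p`:
`∫_Q |f - f_Q| ^ p ≤ (2 ^ (N + 2) p) ^ p ∫_Q (f^#) ^ p`.

Behind it is a Calderón-Zygmund stopping-time argument. Starting from `Q`, pass from a stopping
cube `R` with oscillation `t = ⨍_R |f - f_R|` to its maximal dyadic subcubes `P` for which
`⨍_P |f - f_R| > 2 t`. These fill at most half of `R`, and `|f_P - f_R| ≤ 2 ^ (N + 1) t`, so
`|f - f_Q|` is at most `2 ^ (N + 1)` times the sum `S` of the oscillations over the stopping cubes
containing the point. On the half of `R` not covered by further stopping cubes `t ≤ f^#`, and by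
convexity an increment `r` of `S` increases `S ^ p` by at most `p r S ^ (p - 1)`; together these
give `∫ S ^ p ≤ 2 p ∫ f^# S ^ (p - 1)`, hence `‖S‖_p ≤ 2 p ‖f^#‖_p`.

Neither the stopping cubes nor `S` are constructed. For the conditional expectation `dyadicMean` of
`f` on the `n`-th dyadic generation, the estimate is a single induction on `n`
(`lintegral_dyadicMean_bellman`) over inequalities that carry the state of the stopping process as
parameters and in which the powers of `S` are already absorbed by Young's inequality. Lebesgue
differentiation and Fatou's lemma let `n` tend to infinity.
-/

/-! ### Non-increasing rearrangements -/

theorem rearrangement_antitone {N : ℕ} (g : (Fin N → ℝ) → ENNReal) :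
    Antitone (rearrangement g) := fun _ _ h =>
  sInf_le_sInf fun _ hs => le_trans hs (ENNReal.ofReal_le_ofReal h)

/-- No measurability of `F` is required: the lower integral of `F ^ p` is a supremum over simple
functions `φ ≤ F ^ p`, and the layer-cake formula is applied to these. -/
theorem setLIntegral_rpow_le_lintegral_rearrangement {N : ℕ} (F : (Fin N → ℝ) → ENNReal)
    {A : Set (Fin N → ℝ)} (hfin : volume A ≠ ⊤) {p : ℝ} (hp : 0 < p) :
    ∫⁻ x in A, F x ^ p ≤ ∫⁻ t in Set.Ioo 0 (volume.real A), rearrangement F t ^ p := by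
  rw [lintegral_eq_nnreal]
  refine iSup₂_le fun φ hφ => ?_
  set D : ℝ → ENNReal := fun l => volume.restrict A {x | l < (φ x : ℝ)} with hD
  have hDanti : Antitone D := fun l l' h => measure_mono fun x hx => lt_of_le_of_lt h hx
  have hDle : ∀ l, D l ≤ volume A := fun l => by
    refine (measure_mono (Set.subset_univ _)).trans ?_
    rw [Measure.restrict_apply_univ]
  have hS : MeasurableSet {q : ℝ × ℝ | ENNReal.ofReal q.2 < D q.1} :=
    measurableSet_lt (ENNReal.measurable_ofReal.comp measurable_snd)
      (hDanti.measurable.comp measurable_fst)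
  have layer : (φ.map ((↑) : NNReal → ENNReal)).lintegral (volume.restrict A)
      = ∫⁻ l in Set.Ioi (0 : ℝ), D l := by
    rw [← SimpleFunc.lintegral_eq_lintegral,
      ← lintegral_eq_lintegral_meas_lt (volume.restrict A) (f := fun x => (φ x : ℝ))
        (Filter.Eventually.of_forall fun x => (φ x).2)
        (φ.measurable.coe_nnreal_real.aemeasurable)]
    simp
  rw [layer]
  calc ∫⁻ l in Set.Ioi (0 : ℝ), D l
      ≤ ∫⁻ l in Set.Ioi (0 : ℝ), ∫⁻ t in Set.Ioo 0 (volume.real A),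
          Set.indicator {q : ℝ × ℝ | ENNReal.ofReal q.2 < D q.1} 1 (l, t) := by
        refine lintegral_mono fun l => ?_
        have hl : D l ≠ ⊤ := ne_top_of_le_ne_top hfin (hDle l)
        have : (fun t : ℝ => Set.indicator {q : ℝ × ℝ | ENNReal.ofReal q.2 < D q.1}
            (1 : ℝ × ℝ → ENNReal) (l, t))
            = Set.indicator {t : ℝ | ENNReal.ofReal t < D l} 1 := by
          ext t; simp [Set.indicator]
        simp only [this]
        rw [lintegral_indicator_one (measurableSet_lt ENNReal.measurable_ofReal measurable_const),
          Measure.restrict_apply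
            (measurableSet_lt ENNReal.measurable_ofReal measurable_const)]
        calc D l = volume (Set.Ioo 0 (D l).toReal) := by
              rw [Real.volume_Ioo, sub_zero, ENNReal.ofReal_toReal hl]
          _ ≤ _ := by
              refine measure_mono fun t ht => ⟨?_, ht.1, ?_⟩
              · rw [Set.mem_ofPred_eq, ENNReal.ofReal_lt_iff_lt_toReal ht.1.le hl]
                exact ht.2
              · exact ht.2.trans_le (ENNReal.toReal_mono hfin (hDle l))
    _ = ∫⁻ t in Set.Ioo 0 (volume.real A), ∫⁻ l in Set.Ioi (0 : ℝ),
          Set.indicator {q : ℝ × ℝ | ENNReal.ofReal q.2 < D q.1} 1 (l, t) :=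
        lintegral_lintegral_swap (measurable_one.indicator hS).aemeasurable
    _ ≤ ∫⁻ t in Set.Ioo 0 (volume.real A), rearrangement F t ^ p := by
        refine lintegral_mono fun t => ?_
        have hm : MeasurableSet {l : ℝ | ENNReal.ofReal t < D l} :=
          measurableSet_lt measurable_const hDanti.measurable
        have : (fun l : ℝ => Set.indicator {q : ℝ × ℝ | ENNReal.ofReal q.2 < D q.1}
            (1 : ℝ × ℝ → ENNReal) (l, t))
            = Set.indicator {l : ℝ | ENNReal.ofReal t < D l} 1 := by
          ext l; simp [Set.indicator]
        simp only [this]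
        rw [lintegral_indicator_one hm, Measure.restrict_apply hm]
        have key : ∀ l : ℝ, 0 < l → ENNReal.ofReal t < D l →
            ENNReal.ofReal l ≤ rearrangement F t ^ p := by
          intro l hl0 hl
          rw [← ENNReal.rpow_inv_le_iff hp]
          refine le_sInf fun s hs => ?_
          rw [ENNReal.rpow_inv_le_iff hp]
          by_contra! hlt
          refine absurd hs (not_le.2 (hl.trans_le ?_))
          refine (Measure.restrict_apply_le _ _).trans (measure_mono fun x hx => ?_)
          have h1 : ENNReal.ofReal l < (φ x : ENNReal) := by
            rw [← ENNReal.ofReal_coe_nnreal]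
            exact (ENNReal.ofReal_lt_ofReal_iff (hl0.trans hx)).2 hx
          exact (ENNReal.rpow_lt_rpow_iff hp).1 (hlt.trans (h1.trans_le (hφ x)))
        by_cases hG : rearrangement F t ^ p = ⊤
        · rw [hG]; exact le_top
        calc _ ≤ volume (Set.Ioc 0 (rearrangement F t ^ p).toReal) := by
              refine measure_mono fun l hl => ⟨hl.2, ?_⟩
              exact (ENNReal.ofReal_le_iff_le_toReal hG).1 (key l hl.2 hl.1)
          _ = _ := by rw [Real.volume_Ioc, sub_zero, ENNReal.ofReal_toReal hG]

/-! ### The weight -/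

/-- The averages over `(0, s)` of a non-increasing function decrease in `s`. -/
theorem ofReal_mul_lintegral_le_of_antitone {A : ℝ → ENNReal} (hA : Antitone A) {V θ : ℝ}
    (hV : 0 ≤ V) (h0 : 0 ≤ θ) (h1 : θ ≤ 1) :
    ENNReal.ofReal θ * ∫⁻ t in Set.Ioo 0 V, A t ≤ ∫⁻ t in Set.Ioo 0 (θ * V), A t := by
  have hθ : θ * V ≤ V := mul_le_of_le_one_left hV h1
  set I₁ := ∫⁻ t in Set.Ioo 0 (θ * V), A t
  have hsplit : ∫⁻ t in Set.Ioo 0 V, A t ≤ I₁ + ∫⁻ t in Set.Ico (θ * V) V, A t := by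
    refine (lintegral_mono_set (fun t ht => ?_)).trans (lintegral_union_le _ _ _)
    rcases lt_or_ge t (θ * V) with h | h
    · exact Or.inl ⟨ht.1, h⟩
    · exact Or.inr ⟨h, ht.2⟩
  have hI1 : A (θ * V) * ENNReal.ofReal (θ * V) ≤ I₁ := by
    calc _ = ∫⁻ _ in Set.Ioo 0 (θ * V), A (θ * V) := by simp
      _ ≤ _ := setLIntegral_mono' measurableSet_Ioo fun t ht => hA ht.2.le
  have hI2 : ∫⁻ t in Set.Ico (θ * V) V, A t ≤ A (θ * V) * ENNReal.ofReal ((1 - θ) * V) := by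
    calc _ ≤ ∫⁻ _ in Set.Ico (θ * V) V, A (θ * V) :=
          setLIntegral_mono' measurableSet_Ico fun t ht => hA ht.1
      _ = _ := by simp [sub_mul]
  calc ENNReal.ofReal θ * ∫⁻ t in Set.Ioo 0 V, A t
      ≤ ENNReal.ofReal θ * (I₁ + A (θ * V) * ENNReal.ofReal ((1 - θ) * V)) := by
        gcongr; exact hsplit.trans (by gcongr)
    _ = ENNReal.ofReal θ * I₁
          + ENNReal.ofReal (1 - θ) * (A (θ * V) * ENNReal.ofReal (θ * V)) := by
        rw [ENNReal.ofReal_mul h0, ENNReal.ofReal_mul (sub_nonneg.2 h1)]; ring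
    _ ≤ ENNReal.ofReal θ * I₁ + ENNReal.ofReal (1 - θ) * I₁ := by gcongr
    _ = I₁ := by
        rw [← add_mul, ← ENNReal.ofReal_add h0 (sub_nonneg.2 h1)]; simp

/-- By Tonelli, the weighted integral is the `ρ`-average over `u ∈ (0, 1)` of the means of `A` over
`(0, u ^ p * V)`, each of which is at least the mean over `(0, V)`. -/
theorem lintegral_le_lintegral_mul_etaWeight {A : ℝ → ENNReal} (hA : Antitone A) {V p : ℝ}
    (hV : 0 < V) (hp : 1 ≤ p) {ρ : ℝ → ℝ} (hρ0 : ∀ t, 0 ≤ ρ t)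
    (hsupp : Function.support ρ ⊆ Set.Ioo 0 1) (hρ : ∫ t in Set.Ioi (0 : ℝ), ρ t = 1) :
    ∫⁻ t in Set.Ioo 0 V, A t ≤ ∫⁻ t in Set.Ioo 0 V, A t * etaWeight ρ p (t / V) := by
  have hp0 : 0 < p := by linarith
  -- The integral is nonzero, so it is not the default value of a non-integrable function.
  have hint : IntegrableOn ρ (Set.Ioi 0) := by
    by_contra h
    rw [integral_undef h] at hρ
    exact zero_ne_one hρ
  have hint' : IntegrableOn ρ (Set.Ioo 0 1) := hint.mono_set Set.Ioo_subset_Ioi_self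
  have hmass : ∫⁻ u in Set.Ioo (0 : ℝ) 1, ENNReal.ofReal (ρ u) = 1 := by
    rw [← ofReal_integral_eq_lintegral_ofReal hint' (Filter.Eventually.of_forall hρ0),
      ← setIntegral_eq_of_subset_of_forall_sdiff_eq_zero measurableSet_Ioi
        Set.Ioo_subset_Ioi_self (fun x hx => ?_), hρ, ENNReal.ofReal_one]
    by_contra h
    exact hx.2 (hsupp h)
  set w : ℝ → ENNReal := fun u => ENNReal.ofReal (ρ u / u ^ p) with hw
  have hwm : AEMeasurable w (volume.restrict (Set.Ioo 0 1)) := by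
    refine AEMeasurable.ennreal_ofReal ?_
    exact hint'.aestronglyMeasurable.aemeasurable.div
      (measurable_id.pow_const p).aemeasurable
  have hS : MeasurableSet {q : ℝ × ℝ | (q.1 / V) ^ (1 / p) < q.2} :=
    measurableSet_lt ((measurable_fst.div_const V).pow_const _) measurable_snd
  set Φ : ℝ × ℝ → ENNReal :=
    Set.indicator {q : ℝ × ℝ | (q.1 / V) ^ (1 / p) < q.2} (fun q => A q.1 * w q.2) with hΦ
  have hΦm : AEMeasurable Φ ((volume.restrict (Set.Ioo 0 V)).prod
      (volume.restrict (Set.Ioo 0 1))) := by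
    refine AEMeasurable.indicator ?_ hS
    exact (hA.measurable.comp measurable_fst).aemeasurable.mul
      (hwm.comp_quasiMeasurePreserving Measure.quasiMeasurePreserving_snd)
  have hleft : ∫⁻ t in Set.Ioo 0 V, A t * etaWeight ρ p (t / V)
      = ∫⁻ t in Set.Ioo 0 V, ∫⁻ u in Set.Ioo (0 : ℝ) 1, Φ (t, u) := by
    refine setLIntegral_congr_fun measurableSet_Ioo fun t ht => ?_
    have hpos : 0 ≤ (t / V) ^ (1 / p) := Real.rpow_nonneg (div_nonneg ht.1.le hV.le) _
    have hset : Set.Ioo ((t / V) ^ (1 / p)) 1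
        = Set.Ioi ((t / V) ^ (1 / p)) ∩ Set.Ioo 0 1 := by
      ext u
      simp only [Set.mem_Ioo, Set.mem_inter_iff, Set.mem_Ioi]
      exact ⟨fun h => ⟨h.1, hpos.trans_lt h.1, h.2⟩, fun h => ⟨h.1, h.2.2⟩⟩
    have hΦt : (fun u => Φ (t, u))
        = Set.indicator (Set.Ioi ((t / V) ^ (1 / p))) (fun u => A t * w u) := by
      ext u; simp [hΦ, Set.indicator]
    change A t * etaWeight ρ p (t / V) = ∫⁻ u in Set.Ioo (0 : ℝ) 1, (fun u => Φ (t, u)) u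
    rw [hΦt, lintegral_indicator measurableSet_Ioi,
      Measure.restrict_restrict measurableSet_Ioi, ← hset, lintegral_const_mul'']
    · rfl
    · refine hwm.mono_measure (Measure.restrict_mono ?_ le_rfl)
      rw [hset]; exact Set.inter_subset_right
  rw [hleft, lintegral_lintegral_swap (f := fun t u => Φ (t, u)) hΦm]
  set I := ∫⁻ t in Set.Ioo 0 V, A t
  calc I = (∫⁻ u in Set.Ioo (0 : ℝ) 1, ENNReal.ofReal (ρ u)) * I := by rw [hmass, one_mul]
    _ = ∫⁻ u in Set.Ioo (0 : ℝ) 1, ENNReal.ofReal (ρ u) * I :=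
        (lintegral_mul_const'' _ hint'.aestronglyMeasurable.aemeasurable.ennreal_ofReal).symm
    _ ≤ _ := by
        refine setLIntegral_mono' measurableSet_Ioo fun u hu => ?_
        have hup : 0 < u ^ p := Real.rpow_pos_of_pos hu.1 p
        have hup1 : u ^ p ≤ 1 := Real.rpow_le_one hu.1.le hu.2.le hp0.le
        have hle : u ^ p * V ≤ V := mul_le_of_le_one_left hV.le hup1
        calc ENNReal.ofReal (ρ u) * I = w u * (ENNReal.ofReal (u ^ p) * I) := by
              rw [← mul_assoc, hw, ← ENNReal.ofReal_mul (div_nonneg (hρ0 u) hup.le),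
                div_mul_cancel₀ _ hup.ne']
          _ ≤ w u * ∫⁻ t in Set.Ioo 0 (u ^ p * V), A t := by
              gcongr; exact ofReal_mul_lintegral_le_of_antitone hA hV.le hup.le hup1
          _ = ∫⁻ t in Set.Ioo 0 (u ^ p * V), A t * w u := by
              rw [lintegral_mul_const _ hA.measurable, mul_comm]
          _ ≤ ∫⁻ t in Set.Ioo 0 (u ^ p * V), Φ (t, u) := by
              refine setLIntegral_mono' measurableSet_Ioo fun t ht => ?_
              rw [hΦ, Set.indicator_of_mem]
              have : t / V < u ^ p := (div_lt_iff₀ hV).2 ht.2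
              calc (t / V) ^ (1 / p) < (u ^ p) ^ (1 / p) :=
                    Real.rpow_lt_rpow (div_nonneg ht.1.le hV.le) this (by positivity)
                _ = u := by rw [one_div, Real.rpow_rpow_inv hu.1.le hp0.ne']
          _ ≤ _ := lintegral_mono_set (Set.Ioo_subset_Ioo_right hle)

/-! ### Dyadic subdivision of a cube -/

/-- The half-open cube with lower corner `a` and edge length `ℓ`. It differs from `cube a ℓ` by a
null set, and its dyadic subcubes are genuinely disjoint. -/
def halfOpenCube {N : ℕ} (a : Fin N → ℝ) (ℓ : ℝ) : Set (Fin N → ℝ) :=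
  Set.pi Set.univ fun i => Set.Ico (a i) (a i + ℓ)

/-- The lower corner of the dyadic child of the cube `(a, ℓ)` that lies, in the `i`-th coordinate,
in the upper half exactly when `σ i` is true. -/
noncomputable def childCorner {N : ℕ} (a : Fin N → ℝ) (ℓ : ℝ) (σ : Fin N → Bool) : Fin N → ℝ :=
  fun i => a i + if σ i then ℓ / 2 else 0

/-- The index of the dyadic child of the cube `(a, ℓ)` that contains `x`. -/
noncomputable def childIndex {N : ℕ} (a : Fin N → ℝ) (ℓ : ℝ) (x : Fin N → ℝ) : Fin N → Bool :=
  fun i => decide (a i + ℓ / 2 ≤ x i)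

/-- The conditional expectation of `f` on the `n`-th dyadic generation of the cube `(a, ℓ)`: at `x`
it is the mean of `f` over the subcube of edge length `ℓ / 2 ^ n` that contains `x`. -/
noncomputable def dyadicMean {N : ℕ} {𝕜 : Type*} [RCLike 𝕜] (f : (Fin N → ℝ) → 𝕜) :
    ℕ → (Fin N → ℝ) → ℝ → (Fin N → ℝ) → 𝕜
  | 0, a, ℓ, _ => meanOn f (cube a ℓ)
  | n + 1, a, ℓ, x => dyadicMean f n (childCorner a ℓ (childIndex a ℓ x)) (ℓ / 2) x

section Geometry

variable {N : ℕ} (a : Fin N → ℝ) (ℓ : ℝ)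

theorem measurableSet_halfOpenCube : MeasurableSet (halfOpenCube a ℓ) :=
  MeasurableSet.univ_pi fun _ => measurableSet_Ico

theorem halfOpenCube_subset_cube : halfOpenCube a ℓ ⊆ cube a ℓ := fun _ hx =>
  ⟨fun i => (hx i trivial).1, fun i => (hx i trivial).2.le⟩

theorem halfOpenCube_ae_eq_cube : halfOpenCube a ℓ =ᵐ[volume] cube a ℓ :=
  Measure.univ_pi_Ico_ae_eq_Icc

theorem restrict_cube : volume.restrict (cube a ℓ) = volume.restrict (halfOpenCube a ℓ) :=
  (Measure.restrict_congr_set (halfOpenCube_ae_eq_cube a ℓ)).symm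

variable {ℓ}

theorem volume_halfOpenCube (hℓ : 0 ≤ ℓ) :
    volume (halfOpenCube a ℓ) = ENNReal.ofReal (ℓ ^ N) := by
  simp [halfOpenCube, volume_pi_pi, ENNReal.ofReal_pow hℓ]

theorem volume_cube (hℓ : 0 ≤ ℓ) : volume (cube a ℓ) = ENNReal.ofReal (ℓ ^ N) := by
  rw [← measure_congr (halfOpenCube_ae_eq_cube a ℓ), volume_halfOpenCube a hℓ]

theorem cube_eq_closedBall (hℓ : 0 ≤ ℓ) :
    cube a ℓ = Metric.closedBall (fun i => a i + ℓ / 2) (ℓ / 2) := by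
  rw [closedBall_pi _ (by positivity), cube, ← Set.pi_univ_Icc]
  refine Set.pi_congr rfl fun i _ => ?_
  rw [Real.closedBall_eq_Icc]
  congr 1 <;> ring

theorem childIndex_eq {σ : Fin N → Bool} {x : Fin N → ℝ}
    (hx : x ∈ halfOpenCube (childCorner a ℓ σ) (ℓ / 2)) : childIndex a ℓ x = σ := by
  ext i
  have h := hx i trivial
  cases hσ : σ i <;> simp [childCorner, hσ, childIndex] at h ⊢ <;> linarith [h.1, h.2]

theorem mem_child (x : Fin N → ℝ) (hx : x ∈ halfOpenCube a ℓ) :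
    x ∈ halfOpenCube (childCorner a ℓ (childIndex a ℓ x)) (ℓ / 2) := by
  intro i _
  have h := hx i trivial
  by_cases hi : a i + ℓ / 2 ≤ x i
  · simp only [childCorner, childIndex, hi, decide_true, if_true, Set.mem_Ico, true_and]
    linarith [h.2]
  · simp only [childCorner, childIndex, hi, decide_false, Bool.false_eq_true, if_false,
      Set.mem_Ico, add_zero]
    exact ⟨h.1, not_le.1 hi⟩

theorem child_subset (hℓ : 0 ≤ ℓ) (σ : Fin N → Bool) :
    halfOpenCube (childCorner a ℓ σ) (ℓ / 2) ⊆ halfOpenCube a ℓ := by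
  intro x hx i _
  have h := hx i trivial
  have h0 : 0 ≤ if σ i then ℓ / 2 else 0 := by positivity
  have h1 : (if σ i then ℓ / 2 else 0) ≤ ℓ / 2 := by split_ifs <;> linarith
  simp only [childCorner, Set.mem_Ico] at h ⊢
  exact ⟨by linarith [h.1], by linarith [h.2]⟩

theorem halfOpenCube_eq_iUnion_child (hℓ : 0 ≤ ℓ) :
    halfOpenCube a ℓ = ⋃ σ, halfOpenCube (childCorner a ℓ σ) (ℓ / 2) :=
  Set.Subset.antisymm (fun x hx => Set.mem_iUnion.2 ⟨_, mem_child a x hx⟩)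
    (Set.iUnion_subset fun σ => child_subset a hℓ σ)

theorem disjoint_child :
    Pairwise (Function.onFun Disjoint fun σ => halfOpenCube (childCorner a ℓ σ) (ℓ / 2)) := by
  intro σ τ hne
  refine Set.disjoint_left.2 fun x hx hx' => hne ?_
  rw [← childIndex_eq a hx, childIndex_eq a hx']

theorem setLIntegral_eq_sum_child (hℓ : 0 ≤ ℓ) (g : (Fin N → ℝ) → ENNReal) :
    ∫⁻ x in halfOpenCube a ℓ, g x
      = ∑ σ, ∫⁻ x in halfOpenCube (childCorner a ℓ σ) (ℓ / 2), g x := by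
  rw [halfOpenCube_eq_iUnion_child a hℓ, lintegral_iUnion
    (fun σ => measurableSet_halfOpenCube _ _) (disjoint_child a), tsum_fintype]

theorem volume_eq_sum_child (hℓ : 0 ≤ ℓ) :
    volume (halfOpenCube a ℓ)
      = ∑ σ, volume (halfOpenCube (childCorner a ℓ σ) (ℓ / 2)) := by
  simpa using setLIntegral_eq_sum_child a hℓ fun _ => 1

end Geometry

section DyadicMean

variable {N : ℕ} {𝕜 : Type*} [RCLike 𝕜] (f : (Fin N → ℝ) → 𝕜)

theorem measurable_childIndex (a : Fin N → ℝ) (ℓ : ℝ) : Measurable (childIndex a ℓ) := by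
  refine measurable_pi_lambda _ fun i => ?_
  refine measurable_to_bool ?_
  have : MeasurableSet {x : Fin N → ℝ | a i + ℓ / 2 ≤ x i} :=
    measurableSet_le measurable_const (measurable_pi_apply i)
  simpa [Set.preimage, childIndex] using this

theorem measurable_dyadicMean (n : ℕ) (a : Fin N → ℝ) (ℓ : ℝ) :
    Measurable (dyadicMean f n a ℓ) := by
  induction n generalizing a ℓ with
  | zero => exact measurable_const
  | succ n ih =>
    have h : Measurable fun q : (Fin N → Bool) × (Fin N → ℝ) =>
        dyadicMean f n (childCorner a ℓ q.1) (ℓ / 2) q.2 :=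
      measurable_from_prod_countable_right fun σ => ih (childCorner a ℓ σ) (ℓ / 2)
    exact h.comp ((measurable_childIndex a ℓ).prodMk measurable_id)

theorem exists_dyadicMean_eq (n : ℕ) (a : Fin N → ℝ) (ℓ : ℝ) {x : Fin N → ℝ}
    (hx : x ∈ halfOpenCube a ℓ) :
    ∃ b, x ∈ cube b (ℓ / 2 ^ n) ∧ dyadicMean f n a ℓ x = meanOn f (cube b (ℓ / 2 ^ n)) := by
  induction n generalizing a ℓ with
  | zero => exact ⟨a, by simpa using halfOpenCube_subset_cube a ℓ hx, by simp [dyadicMean]⟩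
  | succ n ih =>
    obtain ⟨b, hb⟩ := ih _ _ (mem_child a x hx)
    rw [div_div, ← pow_succ'] at hb
    exact ⟨b, hb⟩

/-- Cubes are balls of the sup norm, so this is Lebesgue differentiation along balls that contain
the point without being centred there. -/
theorem ae_tendsto_dyadicMean (hf : LocallyIntegrable f volume) (a : Fin N → ℝ) {ℓ : ℝ}
    (hℓ : 0 < ℓ) : ∀ᵐ x ∂volume.restrict (halfOpenCube a ℓ),
      Filter.Tendsto (fun n => dyadicMean f n a ℓ x) Filter.atTop (nhds (f x)) := by
  rw [ae_restrict_iff' (measurableSet_halfOpenCube a ℓ)]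
  filter_upwards [IsUnifLocDoublingMeasure.ae_tendsto_average (μ := volume) hf 1] with x hx hxa
  choose b hb hmean using fun n => exists_dyadicMean_eq f n a ℓ hxa
  have hpos : ∀ n : ℕ, 0 < ℓ / 2 ^ n / 2 := fun n => by positivity
  have hδ : Filter.Tendsto (fun n : ℕ => ℓ / 2 ^ n / 2) Filter.atTop
      (nhdsWithin 0 (Set.Ioi 0)) := by
    refine tendsto_nhdsWithin_iff.2 ⟨?_, Filter.Eventually.of_forall hpos⟩
    have := (tendsto_pow_atTop_nhds_zero_of_lt_one (r := (1 / 2 : ℝ)) (by norm_num)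
      (by norm_num)).const_mul (ℓ / 2)
    simp only [mul_zero] at this
    refine this.congr fun n => ?_
    rw [one_div, inv_pow]; ring
  refine (hx (fun n i => b n i + ℓ / 2 ^ n / 2) (fun n => ℓ / 2 ^ n / 2) hδ
    (Filter.Eventually.of_forall fun n => ?_)).congr fun n => ?_
  · rw [one_mul, ← cube_eq_closedBall _ (by positivity)]
    exact hb n
  · rw [← cube_eq_closedBall _ (by positivity), hmean n, meanOn]

/-! ### Means and oscillations -/

variable {f}

theorem integrableOn_halfOpenCube (hf : LocallyIntegrable f volume) (a : Fin N → ℝ) (ℓ : ℝ) :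
    IntegrableOn f (halfOpenCube a ℓ) volume :=
  (hf.integrableOn_isCompact isCompact_Icc).mono_set (halfOpenCube_subset_cube a ℓ)

theorem enorm_meanOn_sub_mul_le (hf : LocallyIntegrable f volume) (a : Fin N → ℝ) {ℓ : ℝ}
    (hℓ : 0 < ℓ) (c : 𝕜) :
    ‖meanOn f (cube a ℓ) - c‖ₑ * volume (halfOpenCube a ℓ)
      ≤ ∫⁻ x in halfOpenCube a ℓ, ‖f x - c‖ₑ := by
  have hv : 0 < ℓ ^ N := by positivity
  have hreal : volume.real (halfOpenCube a ℓ) = ℓ ^ N := by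
    rw [Measure.real, volume_halfOpenCube a hℓ.le, ENNReal.toReal_ofReal hv.le]
  have hfin : volume (halfOpenCube a ℓ) ≠ ⊤ := by simp [volume_halfOpenCube a hℓ.le]
  have heq : (ℓ ^ N) • (meanOn f (cube a ℓ) - c) = ∫ x in halfOpenCube a ℓ, (f x - c) := by
    rw [integral_sub (integrableOn_halfOpenCube hf a ℓ) (integrableOn_const hfin),
      setIntegral_const, hreal, smul_sub, meanOn, restrict_cube, setAverage_eq, hreal, smul_smul,
      mul_inv_cancel₀ hv.ne', one_smul]
  calc _ = ‖(ℓ ^ N) • (meanOn f (cube a ℓ) - c)‖ₑ := by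
        rw [enorm_smul, Real.enorm_of_nonneg hv.le, volume_halfOpenCube a hℓ.le, mul_comm]
    _ ≤ _ := by rw [heq]; exact enorm_integral_le_lintegral_enorm _

theorem lintegral_enorm_sub_ne_top (hf : LocallyIntegrable f volume) (a : Fin N → ℝ) (ℓ : ℝ)
    (c : 𝕜) (hℓ : 0 < ℓ) : ∫⁻ x in halfOpenCube a ℓ, ‖f x - c‖ₑ ≠ ⊤ := by
  have hfin : volume (halfOpenCube a ℓ) ≠ ⊤ := by simp [volume_halfOpenCube a hℓ.le]
  exact ((integrableOn_halfOpenCube hf a ℓ).sub (integrableOn_const hfin)).2.ne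

/-- The mean oscillation of `f` over a cube, as a finite number `r` that bounds the sharp maximal
function from below on the cube. -/
theorem exists_oscillation (hf : LocallyIntegrable f volume) (a : Fin N → ℝ) {ℓ : ℝ}
    (hℓ : 0 < ℓ) : ∃ r : ℝ, 0 ≤ r ∧
      ∫⁻ x in halfOpenCube a ℓ, ‖f x - meanOn f (cube a ℓ)‖ₑ
        = ENNReal.ofReal r * volume (halfOpenCube a ℓ) ∧
      ∀ x ∈ halfOpenCube a ℓ, ENNReal.ofReal r ≤ sharpMaximal f x := by
  have hv : 0 < ℓ ^ N := by positivity
  set I := ∫⁻ x in halfOpenCube a ℓ, ‖f x - meanOn f (cube a ℓ)‖ₑ with hI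
  have hIfin : I ≠ ⊤ := lintegral_enorm_sub_ne_top hf a ℓ _ hℓ
  have hvol := volume_halfOpenCube a hℓ.le
  have h0 : volume (halfOpenCube a ℓ) ≠ 0 := by simp [hvol, hv]
  have hfin : volume (halfOpenCube a ℓ) ≠ ⊤ := by simp [hvol]
  refine ⟨(I / volume (halfOpenCube a ℓ)).toReal, ENNReal.toReal_nonneg, ?_, fun x hx => ?_⟩
  · rw [ENNReal.ofReal_toReal (ENNReal.div_ne_top hIfin h0), ENNReal.div_mul_cancel h0 hfin]
  · rw [ENNReal.ofReal_toReal (ENNReal.div_ne_top hIfin h0)]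
    have : I / volume (halfOpenCube a ℓ)
        = ⨍⁻ y, ‖f y - meanOn f (cube a ℓ)‖ₑ ∂(volume.restrict (cube a ℓ)) := by
      rw [restrict_cube, setLAverage_eq]
    rw [this]
    exact le_iSup₂_of_le a ℓ (le_iSup₂_of_le hℓ (halfOpenCube_subset_cube a ℓ hx) le_rfl)

end DyadicMean

/-! ### The Bellman induction -/

/-- The tangent line to `x ↦ x ^ p` at `y` lies below the graph. -/
theorem mul_rpow_sub_one_mul_le {p x y : ℝ} (hp : 1 ≤ p) (hx : 0 ≤ x) (hy : 0 ≤ y) :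
    p * y ^ (p - 1) * x ≤ x ^ p + (p - 1) * y ^ p := by
  rcases hy.eq_or_lt with rfl | hy
  · rcases hp.eq_or_lt with rfl | hp
    · simp
    · rw [Real.zero_rpow (by linarith), Real.zero_rpow (by linarith)]
      simpa using Real.rpow_nonneg hx p
  · have h := one_add_mul_self_le_rpow_one_add (s := x / y - 1) (p := p)
      (by have := div_nonneg hx hy.le; linarith) hp
    have h2 := mul_le_mul_of_nonneg_right h (Real.rpow_nonneg hy.le p)
    rw [show 1 + (x / y - 1) = x / y by ring, Real.div_rpow hx hy.le,
      div_mul_cancel₀ _ (Real.rpow_pos_of_pos hy p).ne'] at h2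
    have h3 : y ^ p = y ^ (p - 1) * y := by
      rw [Real.rpow_sub_one hy.ne', div_mul_cancel₀ _ hy.ne']
    have h4 : x / y * y ^ p = y ^ (p - 1) * x := by rw [h3]; field_simp
    have h5 : (1 + p * (x / y - 1)) * y ^ p = p * (x / y * y ^ p) - (p - 1) * y ^ p := by ring
    rw [h5, h4] at h2
    linarith

theorem self_mul_rpow_sub_one {p x : ℝ} (hx : 0 ≤ x) (hp : 0 < p) : x * x ^ (p - 1) = x ^ p := by
  rw [← Real.rpow_one_add' hx (by linarith), add_sub_cancel]

/-- The tangent line at `s + r`, evaluated at `s`. -/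
theorem rpow_add_le {p s r : ℝ} (hp : 1 ≤ p) (hs : 0 ≤ s) (hr : 0 ≤ r) :
    (s + r) ^ p ≤ s ^ p + p * (r * (s + r) ^ (p - 1)) := by
  have h := mul_rpow_sub_one_mul_le hp hs (add_nonneg hs hr)
  have h3 := self_mul_rpow_sub_one (p := p) (add_nonneg hs hr) (by linarith)
  nlinarith

section Bellman

variable {N : ℕ} {𝕜 : Type*} [RCLike 𝕜] {f : (Fin N → ℝ) → 𝕜}

/-- The induction on the number `n` of dyadic generations. The state attached to a cube consists of
the mean `c` of `f` over the last stopping cube containing it, the mean oscillation `t` of `f` over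
that stopping cube, and the sum `s` of the oscillations over all stopping cubes so far; `m` is the
mean over the initial cube. A child becomes a stopping cube when its mean of `|f - c|` exceeds
`2 * t`. Both sides are additive over children in the same state, while for a new stopping cube
with oscillation `r` the loss in replacing `s` by `s + r` is covered by `rpow_add_le`, and the
excess of `∫ |f - c|` over `2 * t * |Q|` pays for the second term on the left. -/
theorem lintegral_dyadicMean_bellman (hf : LocallyIntegrable f volume) {p : ℝ} (hp : 1 ≤ p)
    (m : 𝕜) {K : ℝ} (hK : K = 2 ^ (N + 1)) (n : ℕ) (a : Fin N → ℝ) {ℓ : ℝ} (hℓ : 0 < ℓ)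
    (c : 𝕜) {s t : ℝ} (ht : 0 ≤ t) (hs : 0 ≤ s) (hcm : ‖c - m‖ + K * t ≤ K * s)
    (hosc : ∫⁻ x in halfOpenCube a ℓ, ‖f x - c‖ₑ
      ≤ ENNReal.ofReal (2 * t) * volume (halfOpenCube a ℓ))
    (hF : ∀ x ∈ halfOpenCube a ℓ, ENNReal.ofReal t ≤ sharpMaximal f x) :
    (∫⁻ x in halfOpenCube a ℓ, ‖dyadicMean f n a ℓ x - m‖ₑ ^ p)
        + ENNReal.ofReal (K ^ p * (2 * p ^ 2 * t * s ^ (p - 1))) * volume (halfOpenCube a ℓ)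
      ≤ ENNReal.ofReal (K ^ p * (2 * p) ^ p) * (∫⁻ x in halfOpenCube a ℓ, sharpMaximal f x ^ p)
        + ENNReal.ofReal (K ^ p * (p * s ^ p)) * volume (halfOpenCube a ℓ)
        + ENNReal.ofReal (K ^ p * (p ^ 2 * s ^ (p - 1)))
          * ∫⁻ x in halfOpenCube a ℓ, ‖f x - c‖ₑ := by
  have hp0 : 0 < p := by linarith
  have hK0 : 0 < K := by rw [hK]; positivity
  have hK2 : 2 ≤ K := by
    rw [hK, pow_succ]; nlinarith [one_le_pow₀ (one_le_two : (1 : ℝ) ≤ 2) (n := N)]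
  have hKp : 0 < K ^ p := Real.rpow_pos_of_pos hK0 p
  induction n generalizing a ℓ c s t with
  | zero =>
    set H := halfOpenCube a ℓ with hH
    have hvol := volume_halfOpenCube a hℓ.le
    have hv : 0 < ℓ ^ N := by positivity
    have h1 : ‖meanOn f (cube a ℓ) - c‖ ≤ 2 * t := by
      have h := (enorm_meanOn_sub_mul_le hf a hℓ c).trans hosc
      rw [← hH, ENNReal.mul_le_mul_iff_left (by simp [hH, hvol, hv]) (by simp [hH, hvol]),
        ← ofReal_norm, ENNReal.ofReal_le_ofReal_iff (by positivity)] at h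
      exact h
    have h2 : ‖meanOn f (cube a ℓ) - m‖ ≤ K * s := by
      have := norm_sub_le_norm_sub_add_norm_sub (meanOn f (cube a ℓ)) c m
      nlinarith
    have h3 : ‖meanOn f (cube a ℓ) - m‖ₑ ^ p ≤ ENNReal.ofReal (K ^ p * s ^ p) := by
      rw [← ofReal_norm, ENNReal.ofReal_rpow_of_nonneg (norm_nonneg _) hp0.le,
        ← Real.mul_rpow hK0.le hs]
      exact ENNReal.ofReal_le_ofReal (Real.rpow_le_rpow (norm_nonneg _) h2 hp0.le)
    have h4 : ENNReal.ofReal (t ^ p) * volume H ≤ ∫⁻ x in H, sharpMaximal f x ^ p := by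
      rw [← setLIntegral_const]
      refine setLIntegral_mono' (measurableSet_halfOpenCube a ℓ) fun x hx => ?_
      rw [← ENNReal.ofReal_rpow_of_nonneg ht hp0.le]
      exact ENNReal.rpow_le_rpow (hF x hx) hp0.le
    have hsp : 0 ≤ s ^ p := Real.rpow_nonneg hs p
    have hsp1 : 0 ≤ s ^ (p - 1) := Real.rpow_nonneg hs _
    have htp : 0 ≤ t ^ p := Real.rpow_nonneg ht p
    have h5 : s ^ p + 2 * p ^ 2 * t * s ^ (p - 1) ≤ (2 * p) ^ p * t ^ p + p * s ^ p := by
      -- The tangent line at `s`, evaluated at `2 * p * t`.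
      have h := mul_rpow_sub_one_mul_le hp (x := 2 * p * t) (by positivity) hs
      rw [Real.mul_rpow (by positivity) ht] at h
      linarith
    refine le_trans ?_ le_self_add
    simp only [dyadicMean, setLIntegral_const]
    calc _ ≤ ENNReal.ofReal (K ^ p * s ^ p) * volume H
          + ENNReal.ofReal (K ^ p * (2 * p ^ 2 * t * s ^ (p - 1))) * volume H := by gcongr
      _ = ENNReal.ofReal (K ^ p * (s ^ p + 2 * p ^ 2 * t * s ^ (p - 1))) * volume H := by
          rw [← add_mul, ← ENNReal.ofReal_add (by positivity) (by positivity), mul_add]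
      _ ≤ ENNReal.ofReal (K ^ p * ((2 * p) ^ p * t ^ p + p * s ^ p)) * volume H := by gcongr
      _ = ENNReal.ofReal (K ^ p * (2 * p) ^ p) * (ENNReal.ofReal (t ^ p) * volume H)
          + ENNReal.ofReal (K ^ p * (p * s ^ p)) * volume H := by
          rw [mul_add, ENNReal.ofReal_add (by positivity) (by positivity), add_mul, ← mul_assoc,
            ENNReal.ofReal_mul hKp.le, ENNReal.ofReal_mul (q := t ^ p) (by positivity),
            ENNReal.ofReal_mul hKp.le]
          ring
      _ ≤ _ := by gcongr
  | succ n ih =>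
    rw [setLIntegral_eq_sum_child a hℓ.le fun x => ‖dyadicMean f (n + 1) a ℓ x - m‖ₑ ^ p,
      setLIntegral_eq_sum_child a hℓ.le fun x => sharpMaximal f x ^ p,
      setLIntegral_eq_sum_child a hℓ.le fun x => ‖f x - c‖ₑ, volume_eq_sum_child a hℓ.le,
      Finset.mul_sum, Finset.mul_sum, Finset.mul_sum, Finset.mul_sum, ← Finset.sum_add_distrib,
      ← Finset.sum_add_distrib, ← Finset.sum_add_distrib]
    refine Finset.sum_le_sum fun σ _ => ?_
    set b := childCorner a ℓ σ with hb
    have hℓ2 : 0 < ℓ / 2 := by positivity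
    set P := halfOpenCube b (ℓ / 2) with hP
    have hPm : MeasurableSet P := measurableSet_halfOpenCube _ _
    have hsub : P ⊆ halfOpenCube a ℓ := child_subset a hℓ.le σ
    have hdm : ∫⁻ x in P, ‖dyadicMean f (n + 1) a ℓ x - m‖ₑ ^ p
        = ∫⁻ x in P, ‖dyadicMean f n b (ℓ / 2) x - m‖ₑ ^ p := by
      refine setLIntegral_congr_fun hPm fun x hx => ?_
      simp only [dyadicMean, childIndex_eq a hx, hb]
    rw [hdm]
    have hFP : ∀ x ∈ P, ENNReal.ofReal t ≤ sharpMaximal f x := fun x hx => hF x (hsub hx)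
    have hvol := volume_halfOpenCube b hℓ2.le
    have hv : 0 < (ℓ / 2) ^ N := by positivity
    have hP0 : volume P ≠ 0 := by simp [hP, hvol, hv]
    have hPfin : volume P ≠ ⊤ := by simp [hP, hvol]
    rcases le_or_gt (∫⁻ x in P, ‖f x - c‖ₑ) (ENNReal.ofReal (2 * t) * volume P) with hcase | hcase
    · exact ih b hℓ2 c ht hs hcm hcase hFP
    -- The mean of `|f - c|` over `P` has jumped above `2 t`: restart from the mean of `f` over `P`.
    obtain ⟨r, hr, hrint, hrF⟩ := exists_oscillation hf b hℓ2
    -- The parent did not stop, and `P` fills the fraction `2 ^ (-N)` of it.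
    have h1 : ‖meanOn f (cube b (ℓ / 2)) - c‖ ≤ K * t := by
      have h := (enorm_meanOn_sub_mul_le hf b hℓ2 c).trans
        ((lintegral_mono_set hsub).trans hosc)
      have hv2 : ENNReal.ofReal (2 * t) * volume (halfOpenCube a ℓ)
          = ENNReal.ofReal (K * t) * volume P := by
        rw [volume_halfOpenCube a hℓ.le, hP, hvol, ← ENNReal.ofReal_mul (by positivity),
          ← ENNReal.ofReal_mul (by positivity), hK]
        congr 1
        rw [div_pow, pow_succ]; field_simp
      rw [hv2, ENNReal.mul_le_mul_iff_left hP0 hPfin,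
        ← ofReal_norm, ENNReal.ofReal_le_ofReal_iff (by positivity)] at h
      exact h
    have h2 : ‖meanOn f (cube b (ℓ / 2)) - m‖ + K * r ≤ K * (s + r) := by
      have := norm_sub_le_norm_sub_add_norm_sub (meanOn f (cube b (ℓ / 2))) c m
      linarith
    have h3 := ih b hℓ2 (meanOn f (cube b (ℓ / 2))) hr (add_nonneg hs hr) h2
      (hrint.le.trans (by gcongr; linarith)) hrF
    rw [hrint, ← hP] at h3
    set L := ∫⁻ x in P, ‖dyadicMean f n b (ℓ / 2) x - m‖ₑ ^ p
    set G := ENNReal.ofReal (K ^ p * (2 * p) ^ p) * ∫⁻ x in P, sharpMaximal f x ^ p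
    have hsp : 0 ≤ s ^ p := Real.rpow_nonneg hs p
    have hsp1 : 0 ≤ s ^ (p - 1) := Real.rpow_nonneg hs _
    have hsrp : 0 ≤ (s + r) ^ p := Real.rpow_nonneg (add_nonneg hs hr) p
    have hsrp1 : 0 ≤ (s + r) ^ (p - 1) := Real.rpow_nonneg (add_nonneg hs hr) _
    have h4 : L ≤ G + ENNReal.ofReal (K ^ p * (p * s ^ p)) * volume P := by
      set X := ENNReal.ofReal (K ^ p * (2 * p ^ 2 * r * (s + r) ^ (p - 1))) * volume P with hX
      have hXfin : X ≠ ⊤ := ENNReal.mul_ne_top ENNReal.ofReal_ne_top hPfin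
      refine (ENNReal.add_le_add_iff_right hXfin).1 (h3.trans ?_)
      rw [add_assoc, add_assoc, hX, ← mul_assoc (ENNReal.ofReal _) (ENNReal.ofReal r),
        ← add_mul, ← add_mul,
        ← ENNReal.ofReal_mul (by positivity), ← ENNReal.ofReal_add (by positivity) (by positivity),
        ← ENNReal.ofReal_add (by positivity) (by positivity), mul_assoc (K ^ p), ← mul_add,
        ← mul_add]
      have h5 := mul_le_mul_of_nonneg_left (rpow_add_le hp hs hr) hp0.le
      gcongr G + ENNReal.ofReal (K ^ p * ?_) * _
      linarith
    have h6 : ENNReal.ofReal (K ^ p * (2 * p ^ 2 * t * s ^ (p - 1))) * volume P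
        ≤ ENNReal.ofReal (K ^ p * (p ^ 2 * s ^ (p - 1))) * ∫⁻ x in P, ‖f x - c‖ₑ := by
      rw [show K ^ p * (2 * p ^ 2 * t * s ^ (p - 1))
        = K ^ p * (p ^ 2 * s ^ (p - 1)) * (2 * t) by ring,
        ENNReal.ofReal_mul (by positivity), mul_assoc]
      gcongr
    exact add_le_add h4 h6

/-- The Bellman induction started from the cube itself as first stopping cube, so that `s` and `t`
both equal its oscillation `r`. The remaining terms cancel because `p + p ^ 2 ≤ 2 * p ^ 2`. -/
theorem lintegral_dyadicMean_sub_mean_le (hf : LocallyIntegrable f volume) {p : ℝ} (hp : 1 ≤ p)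
    (n : ℕ) (a : Fin N → ℝ) {ℓ : ℝ} (hℓ : 0 < ℓ) :
    ∫⁻ x in halfOpenCube a ℓ, ‖dyadicMean f n a ℓ x - meanOn f (cube a ℓ)‖ₑ ^ p
      ≤ ENNReal.ofReal (2 ^ (N + 2) * p) ^ p
        * ∫⁻ x in halfOpenCube a ℓ, sharpMaximal f x ^ p := by
  have hp0 : 0 < p := by linarith
  obtain ⟨r, hr, hrint, hrF⟩ := exists_oscillation hf a hℓ
  have h := lintegral_dyadicMean_bellman hf hp (meanOn f (cube a ℓ)) rfl n a hℓ
    (meanOn f (cube a ℓ)) hr hr (by simp) (hrint.le.trans (by gcongr; linarith)) hrF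
  have hPfin : volume (halfOpenCube a ℓ) ≠ ⊤ := by simp [volume_halfOpenCube a hℓ.le]
  set K : ℝ := 2 ^ (N + 1) with hK
  have hK0 : 0 < K := by positivity
  have hrp : r * r ^ (p - 1) = r ^ p := self_mul_rpow_sub_one hr hp0
  have hrp0 : 0 ≤ r ^ p := Real.rpow_nonneg hr p
  have hrp1 : 0 ≤ r ^ (p - 1) := Real.rpow_nonneg hr _
  have hKp : 0 < K ^ p := Real.rpow_pos_of_pos hK0 p
  have hc : ENNReal.ofReal (2 ^ (N + 2) * p) ^ p = ENNReal.ofReal (K ^ p * (2 * p) ^ p) := by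
    rw [ENNReal.ofReal_rpow_of_nonneg (by positivity) hp0.le,
      ← Real.mul_rpow hK0.le (by positivity), hK]
    congr 2; ring
  rw [hc]
  refine (ENNReal.add_le_add_iff_right
    (ENNReal.mul_ne_top ENNReal.ofReal_ne_top hPfin)).1 (h.trans ?_)
  rw [hrint, add_assoc, ← mul_assoc (ENNReal.ofReal _) (ENNReal.ofReal r), ← add_mul,
    ← ENNReal.ofReal_mul (by positivity),
    ← ENNReal.ofReal_add (by positivity) (by positivity)]
  gcongr
  have h1 : K ^ p * (p ^ 2 * r ^ (p - 1)) * r = K ^ p * (p ^ 2 * r ^ p) := by rw [← hrp]; ring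
  have h2 : K ^ p * (2 * p ^ 2 * r * r ^ (p - 1)) = K ^ p * (2 * p ^ 2 * r ^ p) := by
    rw [← hrp]; ring
  rw [h1, h2, ← mul_add]
  gcongr
  nlinarith [mul_nonneg (mul_nonneg hp0.le (sub_nonneg.2 hp)) hrp0]

/-- A local Fefferman-Stein inequality whose constant grows linearly in `p`, obtained from the
dyadic means by Fatou's lemma. -/
theorem setLIntegral_sub_mean_le_sharpMaximal (hf : LocallyIntegrable f volume) {p : ℝ}
    (hp : 1 ≤ p) (a : Fin N → ℝ) {ℓ : ℝ} (hℓ : 0 < ℓ) :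
    ∫⁻ x in cube a ℓ, ‖f x - meanOn f (cube a ℓ)‖ₑ ^ p
      ≤ ENNReal.ofReal (2 ^ (N + 2) * p) ^ p * ∫⁻ x in cube a ℓ, sharpMaximal f x ^ p := by
  rw [restrict_cube]
  set m := meanOn f (cube a ℓ)
  have hlim : ∀ᵐ x ∂volume.restrict (halfOpenCube a ℓ), ‖f x - m‖ₑ ^ p
      = Filter.liminf (fun n => ‖dyadicMean f n a ℓ x - m‖ₑ ^ p) Filter.atTop := by
    filter_upwards [ae_tendsto_dyadicMean f hf a hℓ] with x hx
    exact ((ENNReal.continuous_rpow_const.tendsto _).comp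
      ((hx.sub_const m).enorm)).liminf_eq.symm
  rw [lintegral_congr_ae hlim]
  refine (lintegral_liminf_le fun n =>
    ((measurable_dyadicMean f n a ℓ).sub_const m).enorm.pow_const p).trans ?_
  exact Filter.liminf_le_of_frequently_le' (Filter.Frequently.of_forall fun n =>
    lintegral_dyadicMean_sub_mean_le hf hp n a hℓ)

end Bellman

/-! ### The estimate on a cube -/

theorem theorem1p4 (N : ℕ) (hN : 1 ≤ N) :
    ∃ C : ℝ, 0 < C ∧
      ∀ (𝕜 : Type*) [RCLike 𝕜] (p : ℝ), 1 ≤ p →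
      ∀ ρ : ℝ → ℝ → ℝ,
        (∀ ε : ℝ, 0 < ε → ∀ t : ℝ, 0 ≤ ρ ε t) →
        (∀ ε : ℝ, 0 < ε → Function.support (ρ ε) ⊆ Set.Ioo 0 1) →
        (∀ ε : ℝ, 0 < ε → ∫ t in Set.Ioi (0 : ℝ), ρ ε t = 1) →
      ∀ f : (Fin N → ℝ) → 𝕜, MemLp f (ENNReal.ofReal p) volume →
      ∀ ε : ℝ, 0 < ε →
      ∀ (a : Fin N → ℝ) (ℓ : ℝ), 0 < ℓ →
        (⨍⁻ x, ‖f x - meanOn f (cube a ℓ)‖ₑ ^ p ∂(volume.restrict (cube a ℓ))) ^ (1 / p) ≤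
          ENNReal.ofReal (C * p) *
            ((volume (cube a ℓ))⁻¹ *
              ∫⁻ t in Set.Ioo 0 (volume.real (cube a ℓ)),
                rearrangement (sharpMaximal f) t ^ p *
                  etaWeight (ρ ε) p (t / volume.real (cube a ℓ))) ^ (1 / p) := by
  refine ⟨2 ^ (N + 2), by positivity, fun 𝕜 _ p hp ρ hρ0 hsupp hρ f hf ε hε a ℓ hℓ => ?_⟩
  have hp0 : 0 < p := by linarith
  have hloc : LocallyIntegrable f volume :=
    hf.locallyIntegrable (by rw [← ENNReal.ofReal_one]; exact ENNReal.ofReal_le_ofReal hp)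
  have hvol := volume_cube a hℓ.le
  have hV : 0 < volume.real (cube a ℓ) := by
    rw [Measure.real, hvol, ENNReal.toReal_ofReal (by positivity)]; positivity
  have hfin : volume (cube a ℓ) ≠ ⊤ := by simp [hvol]
  have hanti : Antitone fun t => rearrangement (sharpMaximal f) t ^ p := fun t t' h =>
    ENNReal.rpow_le_rpow (rearrangement_antitone _ h) hp0.le
  have key := (setLIntegral_sub_mean_le_sharpMaximal hloc hp a hℓ).trans (mul_le_mul_right
    ((setLIntegral_rpow_le_lintegral_rearrangement (sharpMaximal f) hfin hp0).trans
      (lintegral_le_lintegral_mul_etaWeight hanti hV hp (hρ0 ε hε) (hsupp ε hε) (hρ ε hε))) _)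
  rw [one_div, ENNReal.rpow_inv_le_iff hp0, ENNReal.mul_rpow_of_nonneg _ _ hp0.le,
    ENNReal.rpow_inv_rpow hp0.ne', setLAverage_eq, ENNReal.div_eq_inv_mul, mul_left_comm]
  gcongr
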